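/- Let $N = q_1\cdots q_u$ be a product of $u$ distinct odd primes. Let $|0\rangle,\dots,|N-1\rangle$ be the standard basis of $\mathbb{C}^N$, labelled by $\mathbb{Z}_N$, and put $\omega = e^{2\pi i/N}$, $\tau = -e^{\pi i/N}$, $X|v\rangle = |v+1\rangle$, $Z|v\rangle = \omega^{v}|v\rangle$. For $\mathbf{p} = (p_1,p_2)^{T}\in\mathbb{Z}_N^2$ let $D_{\mathbf{p}} = \tau^{p_1p_2}X^{p_1}Z^{p_2}$. (This is well defined since $N$ is odd.) For $\mathcal{G}\in \mathrm{SL}(2,\mathbb{Z}_N)$ let $U_{\mathcal{G}}$ be the unitary, unique up to a phase, such that $U_{\mathcal{G}}D_{\mathbf{p}}U_{\mathcal{G}}^{\dagger} = D_{\mathcal{G}\mathbf{p}}$ for all $\mathbf{p}\in\mathbb{Z}_N^2$. Let $\mathcal{G}\in \mathrm{SL}(2,\mathbb{Z}_N)$ be any matrix other than the identity whose order divides $N$. Then $\mathcal{G}$ generates linear dependencies in every eigenspace, that is: for each eigenvector $|\psi\rangle$ of $U_{\mathcal{G}}$ there exist $N$ distinct points $\mathbf{p}_1,\dots,\mathbf{p}_N\in\mathbb{Z}_N^2$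 such that the $N$ vectors $D_{\mathbf{p}_1}|\psi\rangle,\dots,D_{\mathbf{p}_N}|\psi\rangle$ are linearly dependent. -/

import Mathlib

open scoped MatrixGroups Matrix

namespace WeylHeisenberg

noncomputable section

/-! The Hilbert space of dimension `N` is `ZMod N → ℂ`; its standard basis vectors
`|0⟩, …, |N - 1⟩` are indexed by `ZMod N`. Everything below is meant for odd `N`, so that
displacement operators and symplectic matrices live over `ZMod N`. -/

/-- `ω = exp (2πi / N)`. -/
def omega (N : ℕ) : ℂ := Complex.exp (2 * Real.pi * Complex.I / N)

/-- `τ = -exp (πi / N)`. -/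
def tau (N : ℕ) : ℂ := -Complex.exp (Real.pi * Complex.I / N)

/-- The shift operator `X |u⟩ = |u + 1⟩`. -/
def shiftX (N : ℕ) : Matrix (ZMod N) (ZMod N) ℂ :=
  Matrix.of fun v u => if v = u + 1 then 1 else 0

/-- The phase operator `Z |u⟩ = ω ^ u |u⟩`. -/
def phaseZ (N : ℕ) : Matrix (ZMod N) (ZMod N) ℂ :=
  Matrix.diagonal fun u => omega N ^ u.val

/-- The displacement operator `D_p = τ ^ (p₁ p₂) X ^ p₁ Z ^ p₂` (for odd `N` one has
`τ ^ N = 1`, so the choice of representatives of `p₁` and `p₂` does not matter). -/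
def displacement (N : ℕ) [NeZero N] (p : Fin 2 → ZMod N) : Matrix (ZMod N) (ZMod N) ℂ :=
  tau N ^ ((p 0).val * (p 1).val) • (shiftX N ^ (p 0).val * phaseZ N ^ (p 1).val)

/-- `U` is a symplectic unitary `U_G` corresponding to `G`: it is unitary and
`U D_p U† = D_{G p}` for all `p`. -/
def IsSymplecticUnitary {N : ℕ} [NeZero N] (G : SL(2, ZMod N))
    (U : Matrix (ZMod N) (ZMod N) ℂ) : Prop :=
  U ∈ Matrix.unitaryGroup (ZMod N) ℂ ∧
    ∀ p : Fin 2 → ZMod N,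
      U * displacement N p * Uᴴ = displacement N ((G : Matrix (Fin 2) (Fin 2) (ZMod N)) *ᵥ p)

/-- `G` generates linear dependencies in all eigenspaces: for each eigenvector `ψ` of `U_G`
(whatever the choice of its phase) there are `N` distinct points `p₁, …, p_N` such that the
family `D_{p₁} ψ, …, D_{p_N} ψ` is linearly dependent. -/
def GeneratesLinearDependencies {N : ℕ} [NeZero N] (G : SL(2, ZMod N)) : Prop :=
  ∀ U : Matrix (ZMod N) (ZMod N) ℂ, IsSymplecticUnitary G U →
    ∀ (c : ℂ) (ψ : ZMod N → ℂ), Module.End.HasEigenvector (Matrix.toLin' U) c ψ →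
      ∃ p : Fin N → (Fin 2 → ZMod N), Function.Injective p ∧
        ¬ LinearIndependent ℂ (fun i => displacement N (p i) *ᵥ ψ)

/-! ### Every `G` has a symplectic unitary when `N` is odd -/

section Existence

variable {N : ℕ} [NeZero N]

theorem omega_pow (k : ℕ) : omega N ^ k = ZMod.stdAddChar (k : ZMod N) := by
  have h := ZMod.stdAddChar_coe (N := N) (k : ℤ)
  rw [Int.cast_natCast] at h
  rw [h, omega, ← Complex.exp_nat_mul]
  congr 1
  push_cast
  ring

theorem tau_eq (hN : Odd N) : tau N = ZMod.stdAddChar ((2 : ZMod N)⁻¹) := by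
  obtain ⟨m, hm⟩ := hN
  have h2 : (2 : ZMod N) * ((m + 1 : ℕ) : ZMod N) = 1 := by
    have : (2 : ZMod N) * ((m + 1 : ℕ) : ZMod N) = ((N + 1 : ℕ) : ZMod N) := by
      rw [hm]; push_cast; ring
    rw [this]; simp
  have h3 : (2 : ZMod N)⁻¹ = ((m + 1 : ℕ) : ZMod N) := ZMod.inv_eq_of_mul_eq_one N _ _ h2
  rw [h3, ← omega_pow, omega, tau, ← Complex.exp_nat_mul]
  have hN0 : (N : ℂ) ≠ 0 := Nat.cast_ne_zero.mpr (NeZero.ne N)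
  have : ((m + 1 : ℕ) : ℂ) * (2 * Real.pi * Complex.I / N)
      = Real.pi * Complex.I / N + Real.pi * Complex.I := by
    have h4 : (N : ℂ) = 2 * m + 1 := by rw [hm]; push_cast; ring
    field_simp
    rw [h4]; push_cast; ring
  rw [this, Complex.exp_add, Complex.exp_pi_mul_I]
  ring

theorem shiftX_pow (k : ℕ) :
    shiftX N ^ k = Matrix.of fun v u => if v = u + (k : ZMod N) then (1 : ℂ) else 0 := by
  induction k with
  | zero =>
    ext v u
    simp [Matrix.one_apply]
  | succ k ih =>
    ext v u
    rw [pow_succ, ih, Matrix.mul_apply]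
    simp only [shiftX, Matrix.of_apply, mul_ite, mul_one, mul_zero, Finset.sum_ite_eq',
      Finset.mem_univ, if_true]
    push_cast
    congr 2
    ring

theorem displacement_apply (hN : Odd N) (p : Fin 2 → ZMod N) (v u : ZMod N) :
    displacement N p v u =
      if v = u + p 0 then ZMod.stdAddChar ((2 : ZMod N)⁻¹ * (p 0 * p 1) + p 1 * u) else 0 := by
  have h1 : tau N ^ ((p 0).val * (p 1).val) = ZMod.stdAddChar ((2 : ZMod N)⁻¹ * (p 0 * p 1)) := by
    rw [tau_eq hN, ← AddChar.map_nsmul_eq_pow, nsmul_eq_mul]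
    push_cast
    simp only [ZMod.natCast_zmod_val]
    congr 1; ring
  have h2 : (omega N ^ u.val) ^ (p 1).val = ZMod.stdAddChar (p 1 * u) := by
    rw [← pow_mul, omega_pow]
    push_cast
    simp only [ZMod.natCast_zmod_val]
    congr 1; ring
  rw [displacement, Matrix.smul_apply, shiftX_pow, phaseZ, Matrix.diagonal_pow,
    Matrix.mul_diagonal, h1]
  simp only [Matrix.of_apply, Pi.pow_apply, h2, ZMod.natCast_zmod_val, smul_eq_mul]
  split_ifs
  · rw [one_mul, AddChar.map_add_eq_mul]
  · simp

theorem IsSymplecticUnitary.mul {G H : SL(2, ZMod N)} {U V : Matrix (ZMod N) (ZMod N) ℂ}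
    (hU : IsSymplecticUnitary G U) (hV : IsSymplecticUnitary H V) :
    IsSymplecticUnitary (G * H) (U * V) := by
  refine ⟨mul_mem hU.1 hV.1, fun p => ?_⟩
  rw [Matrix.conjTranspose_mul, Matrix.SpecialLinearGroup.coe_mul, ← Matrix.mulVec_mulVec,
    ← hU.2, ← hV.2]
  simp only [Matrix.mul_assoc]

theorem exists_of_unit (hN : Odd N) (G : SL(2, ZMod N)) (b : ZMod N) (hb : G 0 1 * b = 1) :
    ∃ U, IsSymplecticUnitary G U := by
  set h : ZMod N := (2 : ZMod N)⁻¹ with hh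
  have h2 : 2 * h = 1 := by
    refine ZMod.mul_inv_of_unit 2 ?_
    have := (ZMod.isUnit_iff_coprime 2 N).mpr (Nat.coprime_two_left.mpr hN)
    exact_mod_cast this
  have hdet : G 0 0 * G 1 1 - G 0 1 * G 1 0 = 1 := by
    have := G.det_coe
    rwa [Matrix.det_fin_two] at this
  set r : ℂ := ((Real.sqrt N : ℝ) : ℂ)⁻¹ with hr
  have hN0 : (N : ℂ) ≠ 0 := Nat.cast_ne_zero.mpr (NeZero.ne N)
  have hrr : r * r * N = 1 := by
    rw [hr, ← mul_inv, ← Complex.ofReal_mul, Real.mul_self_sqrt (Nat.cast_nonneg N)]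
    simp [hN0]
  let q : ZMod N → ZMod N → ZMod N := fun u v =>
    h * b * (G 1 1 * u ^ 2 - 2 * u * v + G 0 0 * v ^ 2)
  let U : Matrix (ZMod N) (ZMod N) ℂ := Matrix.of fun u v => r * ZMod.stdAddChar (q u v)
  have hconj : ∀ x : ZMod N, star (ZMod.stdAddChar x : ℂ) = ZMod.stdAddChar (-x) := fun x => by
    rw [AddChar.map_neg_eq_conj]; rfl
  have hrs : star r = r := by
    rw [hr]; simp
  have hUU : Uᴴ * U = 1 := by
    ext v w
    have key : ∀ u : ZMod N, Uᴴ v u * U u w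
        = (r * r * ZMod.stdAddChar (h * b * G 0 0 * (w ^ 2 - v ^ 2))) * ZMod.stdAddChar (u * (b * (v - w))) := by
      intro u
      simp only [U, Matrix.conjTranspose_apply, Matrix.of_apply, star_mul', hconj, hrs]
      have : (-q u v + q u w) = h * b * G 0 0 * (w ^ 2 - v ^ 2) + u * (b * (v - w)) := by
        simp only [q]
        linear_combination u * b * (v - w) * h2
      calc r * ZMod.stdAddChar (-q u v) * (r * ZMod.stdAddChar (q u w)) = r * r * (ZMod.stdAddChar (-q u v) * ZMod.stdAddChar (q u w)) := by ring
        _ = _ := by rw [← AddChar.map_add_eq_mul, this, AddChar.map_add_eq_mul]; ring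
    rw [Matrix.mul_apply, Finset.sum_congr rfl fun u _ => key u, ← Finset.mul_sum,
      AddChar.sum_mulShift _ (ZMod.isPrimitive_stdAddChar N)]
    by_cases hvw : v = w
    · subst hvw
      simp [hrr]
    · have : b * (v - w) ≠ 0 := by
        intro h0
        apply hvw
        linear_combination G 0 1 * h0 - (v - w) * hb
      simp [this, hvw]
  have hU : U ∈ Matrix.unitaryGroup (ZMod N) ℂ := Matrix.mem_unitaryGroup_iff'.mpr hUU
  refine ⟨U, hU, fun p => ?_⟩
  have hUU' : U * Uᴴ = 1 := Matrix.mem_unitaryGroup_iff.mp hU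
  have hcomm : U * displacement N p
      = displacement N ((G : Matrix (Fin 2) (Fin 2) (ZMod N)) *ᵥ p) * U := by
    ext x u
    set s := (G : Matrix (Fin 2) (Fin 2) (ZMod N)) *ᵥ p with hs
    have hs0 : s 0 = G 0 0 * p 0 + G 0 1 * p 1 := by
      simp [hs]
    have hs1 : s 1 = G 1 0 * p 0 + G 1 1 * p 1 := by
      simp [hs]
    rw [Matrix.mul_apply, Matrix.mul_apply, Finset.sum_eq_single (u + p 0),
      Finset.sum_eq_single (x - s 0)]
    · simp only [displacement_apply hN, U, Matrix.of_apply, if_true, sub_add_cancel]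
      have hexp : q x (u + p 0) + (h * (p 0 * p 1) + p 1 * u)
          = h * (s 0 * s 1) + s 1 * (x - s 0) + q (x - s 0) u := by
        simp only [q, hs0, hs1]
        linear_combination
          (-2 * h * p 1 * u + 2 * h * (G 1 0 * p 0 + G 1 1 * p 1) * x
            - h * (p 0 * p 1
              + (G 0 0 * p 0 + G 0 1 * p 1) * (G 1 0 * p 0 + G 1 1 * p 1))) * hb
          + (-p 1 * u + (G 1 0 * p 0 + G 1 1 * p 1) * x
            - (G 0 0 * p 0 + G 0 1 * p 1) * (G 1 0 * p 0 + G 1 1 * p 1)) * h2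
          + (2 * h * b * x * p 0 - h * b * (G 0 0 * p 0 + G 0 1 * p 1) * p 0) * hdet
      rw [mul_assoc, mul_left_comm _ r, ← AddChar.map_add_eq_mul, ← AddChar.map_add_eq_mul, hexp]
    · intro y _ hy
      rw [displacement_apply hN, if_neg, zero_mul]
      intro hx
      apply hy
      rw [hx]; ring
    · simp
    · intro y _ hy
      rw [displacement_apply hN, if_neg hy, mul_zero]
    · simp
  rw [hcomm, Matrix.mul_assoc, hUU', Matrix.mul_one]

theorem exists_unit_add (G : SL(2, ZMod N)) : ∃ c : ZMod N, IsUnit (G 0 0 + G 0 1 * c) := by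
  have hdet : G 0 0 * G 1 1 - G 0 1 * G 1 0 = 1 := by
    have := G.det_coe
    rwa [Matrix.det_fin_two] at this
  set a := (G 0 0).val with ha
  set b := (G 0 1).val with hb
  let k : ℕ := ∏ p ∈ N.primeFactors.filter (fun p => ¬ p ∣ a), p
  refine ⟨(k : ZMod N), ?_⟩
  have hcast : G 0 0 + G 0 1 * (k : ZMod N) = ((a + b * k : ℕ) : ZMod N) := by
    push_cast
    rw [ha, hb, ZMod.natCast_zmod_val, ZMod.natCast_zmod_val]
  rw [hcast, ZMod.isUnit_iff_coprime]
  refine Nat.coprime_of_dvd fun p hp hpa hpN => ?_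
  have hpmem : p ∈ N.primeFactors := Nat.mem_primeFactors.mpr ⟨hp, hpN, NeZero.ne N⟩
  by_cases hpa' : p ∣ a
  · have hbk : p ∣ b * k := (Nat.dvd_add_right hpa').mp hpa
    have hpk : ¬ p ∣ k := by
      intro hpk
      obtain ⟨l, hl, hpl⟩ := (hp.prime.dvd_finsetProd_iff _).mp hpk
      rw [Finset.mem_filter, Nat.mem_primeFactors] at hl
      rw [(Nat.prime_dvd_prime_iff_eq hp hl.1.1).mp hpl] at hpa'
      exact hl.2 hpa'
    have hpb : p ∣ b := (hp.dvd_mul.mp hbk).resolve_right hpk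
    have : Fact p.Prime := ⟨hp⟩
    have h0 : ZMod.castHom hpN (ZMod p) (G 0 0) = 0 := by
      rw [← ZMod.natCast_zmod_val (G 0 0), map_natCast]
      exact (ZMod.natCast_eq_zero_iff _ _).mpr hpa'
    have h1 : ZMod.castHom hpN (ZMod p) (G 0 1) = 0 := by
      rw [← ZMod.natCast_zmod_val (G 0 1), map_natCast]
      exact (ZMod.natCast_eq_zero_iff _ _).mpr hpb
    have := congrArg (ZMod.castHom hpN (ZMod p)) hdet
    rw [map_sub, map_mul, map_mul, h0, h1, map_one] at this
    simp at this
  · have hpk : p ∣ k :=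
      Finset.dvd_prod_of_mem (fun p => p) (Finset.mem_filter.mpr ⟨hpmem, hpa'⟩)
    exact hpa' ((Nat.dvd_add_left (hpk.mul_left b)).mp hpa)

theorem exists_isSymplecticUnitary (hN : Odd N) (G : SL(2, ZMod N)) :
    ∃ U, IsSymplecticUnitary G U := by
  obtain ⟨c, hc⟩ := exists_unit_add G
  obtain ⟨w, hw⟩ := hc.exists_right_inv
  let B : SL(2, ZMod N) := ⟨!![-c, 1; -1, 0], by simp [Matrix.det_fin_two]⟩
  have hB : B 0 1 * 1 = 1 := by simp [B]
  let C : SL(2, ZMod N) := ⟨!![0, -1; 1, -c], by simp [Matrix.det_fin_two]⟩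
  have hCB : C * B = 1 := by
    apply Subtype.ext
    rw [Matrix.SpecialLinearGroup.coe_mul, Matrix.SpecialLinearGroup.coe_one]
    simp [B, C, Matrix.one_fin_two]
  have hA : (G * C) 0 1 * (-w) = 1 := by
    rw [Matrix.SpecialLinearGroup.coe_mul, Matrix.mul_apply, Fin.sum_univ_two]
    simp only [C, Matrix.of_apply, Matrix.cons_val', Matrix.cons_val_zero, Matrix.cons_val_one,
      Matrix.cons_val_fin_one]
    linear_combination hw
  obtain ⟨U, hU⟩ := exists_of_unit hN _ _ hA
  obtain ⟨V, hV⟩ := exists_of_unit hN _ _ hB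
  refine ⟨U * V, ?_⟩
  have := hU.mul hV
  rwa [mul_assoc, hCB, mul_one] at this

end Existence

end

end WeylHeisenberg

/-!
The argument rests on the identity `U D_p ψ = c D_{Gp} ψ` for an eigenvector `ψ` of `U` with
eigenvalue `c`. Suppose `P` is a set of `N` points that is stable under `G` and contains no fixed
point of `G`. If the `N` vectors `D_p ψ`, `p ∈ P`, were linearly independent, they would be a basis
of `ℂ ^ N` which `U` permutes, up to the factor `c`, without fixing a basis vector, so `U` would have
trace zero (`trace_eq_zero_of_permutes_basis`). But the trace of a symplectic unitary never vanishes
(`IsSymplecticUnitary.trace_ne_zero`): twirling `Uᴴ` over the displacement operators gives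
`∑ p, D_{Gp} D_pᴴ = N tr(Uᴴ) U`, and the trace of the left-hand side is `N` times the number of
fixed points of `G`, which is positive because `0` is fixed.

The set `P` is a union of regular orbits of the cyclic group generated by `G`, each of which has
`orderOf G` elements; as `orderOf G ∣ N`, one only needs `N` points on regular orbits (see
`exists_invariant_finset`). Over a field of characteristic other than two,
the vectors with a nontrivial stabiliser in `⟨G⟩ ≤ SL(2, F)` all lie on one line
(`exists_linear_form_of_pow_fixes`), and the Chinese remainder theorem combines affine lines which
avoid these, one for every prime factor of `N`, into `N` points on regular orbits
(`exists_injective_regular`).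
-/

open Finset

namespace WeylHeisenberg

/-! ### Traces of symplectic unitaries -/

section Trace

variable {N : ℕ} [NeZero N]

theorem star_stdAddChar (x : ZMod N) :
    star (ZMod.stdAddChar x : ℂ) = ZMod.stdAddChar (-x) := by
  rw [AddChar.map_neg_eq_conj]; rfl

theorem displacement_conj_apply (hN : Odd N) (p : Fin 2 → ZMod N)
    (A : Matrix (ZMod N) (ZMod N) ℂ) (v w : ZMod N) :
    (displacement N p * A * (displacement N p)ᴴ) v w
      = ZMod.stdAddChar (p 1 * (v - w)) * A (v - p 0) (w - p 0) := by
  rw [Matrix.mul_apply, Finset.sum_eq_single (w - p 0), Matrix.mul_apply,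
    Finset.sum_eq_single (v - p 0)]
  · simp only [Matrix.conjTranspose_apply, displacement_apply hN, sub_add_cancel, if_true,
      star_stdAddChar]
    rw [mul_right_comm, ← AddChar.map_add_eq_mul]
    congr 2
    ring
  · intro y _ hy
    rw [displacement_apply hN, if_neg, zero_mul]
    rintro rfl
    exact hy (by ring)
  · simp
  · intro y _ hy
    rw [Matrix.conjTranspose_apply, displacement_apply hN, if_neg, star_zero, mul_zero]
    rintro rfl
    exact hy (by ring)
  · simp

theorem sum_displacement_conj (hN : Odd N) (A : Matrix (ZMod N) (ZMod N) ℂ) :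
    ∑ p : Fin 2 → ZMod N, displacement N p * A * (displacement N p)ᴴ
      = (N * A.trace) • (1 : Matrix (ZMod N) (ZMod N) ℂ) := by
  ext v w
  rw [Matrix.sum_apply, Finset.sum_congr rfl fun p _ => displacement_conj_apply hN p A v w,
    ← (finTwoArrowEquiv (ZMod N)).symm.sum_comp, Fintype.sum_prod_type]
  simp only [finTwoArrowEquiv_symm_apply, Matrix.cons_val_zero, Matrix.cons_val_one,
    ← Finset.sum_mul]
  rw [← Finset.mul_sum, AddChar.sum_mulShift _ (ZMod.isPrimitive_stdAddChar N)]
  by_cases hvw : v = w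
  · subst hvw
    have : ∑ i : ZMod N, A (v - i) (v - i) = A.trace :=
      (Equiv.subLeft v).sum_comp fun i => A i i
    simp [this]
  · simp [sub_ne_zero.mpr hvw, Matrix.one_apply_ne hvw]

theorem trace_displacement_mul_conjTranspose (hN : Odd N) (a b : Fin 2 → ZMod N) :
    (displacement N a * (displacement N b)ᴴ).trace = if a = b then (N : ℂ) else 0 := by
  have key : ∀ u : ZMod N, ∑ v, displacement N a v u * star (displacement N b v u)
      = if a 0 = b 0 then ZMod.stdAddChar ((2 : ZMod N)⁻¹ * (a 0 * a 1 - b 0 * b 1))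
          * ZMod.stdAddChar (u * (a 1 - b 1)) else 0 := by
    intro u
    rw [Finset.sum_eq_single (u + a 0)]
    · simp only [displacement_apply hN, if_true, add_right_inj]
      split_ifs
      · rw [star_stdAddChar, ← AddChar.map_add_eq_mul, ← AddChar.map_add_eq_mul]
        congr 1
        ring
      · simp
    · intro y _ hy
      rw [displacement_apply hN, if_neg hy, zero_mul]
    · simp
  simp only [Matrix.trace, Matrix.diag_apply, Matrix.mul_apply, Matrix.conjTranspose_apply]
  rw [Finset.sum_comm, Finset.sum_congr rfl fun u _ => key u]
  by_cases h0 : a 0 = b 0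
  · simp only [h0, if_true]
    rw [← Finset.mul_sum, AddChar.sum_mulShift _ (ZMod.isPrimitive_stdAddChar N)]
    by_cases h1 : a 1 = b 1
    · have hab : a = b := by ext i; fin_cases i <;> assumption
      simp [hab]
    · have hab : a ≠ b := fun h => h1 (by rw [h])
      simp [sub_ne_zero.mpr h1, hab]
  · have hab : a ≠ b := fun h => h0 (by rw [h])
    simp [h0, hab]

/-- The twirl of `Uᴴ` shows `N tr(Uᴴ) tr(U) = N #{p | G p = p}`, and `p = 0` is fixed. -/
theorem IsSymplecticUnitary.trace_ne_zero (hN : Odd N) {G : SL(2, ZMod N)}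
    {U : Matrix (ZMod N) (ZMod N) ℂ} (hU : IsSymplecticUnitary G U) : U.trace ≠ 0 := by
  intro h
  have h1 : U * ∑ p : Fin 2 → ZMod N, displacement N p * Uᴴ * (displacement N p)ᴴ = 0 := by
    rw [sum_displacement_conj hN, Matrix.trace_conjTranspose, h]
    simp
  have h2 := congrArg Matrix.trace h1
  simp only [Finset.mul_sum, ← Matrix.mul_assoc, hU.2, Matrix.trace_sum,
    trace_displacement_mul_conjTranspose hN, Matrix.trace_zero] at h2
  rw [← Finset.sum_filter, Finset.sum_const, smul_eq_zero] at h2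
  rcases h2 with h2 | h2
  · rw [Finset.card_eq_zero] at h2
    have : (0 : Fin 2 → ZMod N) ∈ (∅ : Finset (Fin 2 → ZMod N)) := by
      rw [← h2]; simp
    simp at this
  · exact NeZero.ne N (Nat.cast_eq_zero.mp h2)

end Trace

/-! ### Linear dependence from freely permuted families -/

theorem trace_eq_zero_of_permutes_basis {K E ι : Type*} [Field K] [AddCommGroup E] [Module K E]
    [Fintype ι] (b : Module.Basis ι K E) (f : E →ₗ[K] E) (c : K) (s : ι → ι)
    (hs : ∀ i, s i ≠ i) (hf : ∀ i, f (b i) = c • b (s i)) : LinearMap.trace K E f = 0 := by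
  classical
  rw [LinearMap.trace_eq_matrix_trace K b, Matrix.trace]
  refine Finset.sum_eq_zero fun i _ => ?_
  rw [Matrix.diag_apply, LinearMap.toMatrix_apply, hf, map_smul, Module.Basis.repr_self]
  simp [Finsupp.single_eq_of_ne (hs i).symm]

theorem mulVec_displacement_mulVec {N : ℕ} [NeZero N] {G : SL(2, ZMod N)}
    {U : Matrix (ZMod N) (ZMod N) ℂ} (hU : IsSymplecticUnitary G U) {c : ℂ} {ψ : ZMod N → ℂ}
    (hψ : U *ᵥ ψ = c • ψ) (p : Fin 2 → ZMod N) :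
    U *ᵥ (displacement N p *ᵥ ψ)
      = c • (displacement N ((G : Matrix (Fin 2) (Fin 2) (ZMod N)) *ᵥ p) *ᵥ ψ) := by
  have hUU : Uᴴ * U = 1 := Matrix.mem_unitaryGroup_iff'.mp hU.1
  rw [← Matrix.mulVec_smul, ← hψ, ← hU.2, Matrix.mulVec_mulVec, Matrix.mulVec_mulVec,
    Matrix.mul_assoc (U * displacement N p), hUU, Matrix.mul_one]

theorem not_linearIndependent_of_invariant {N : ℕ} [NeZero N] (hN : Odd N) {G : SL(2, ZMod N)}
    {U : Matrix (ZMod N) (ZMod N) ℂ} (hU : IsSymplecticUnitary G U) {c : ℂ} {ψ : ZMod N → ℂ}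
    (hψ : U *ᵥ ψ = c • ψ) (p : Fin N → Fin 2 → ZMod N) (s : Fin N → Fin N) (hs : ∀ i, s i ≠ i)
    (hp : ∀ i, (G : Matrix (Fin 2) (Fin 2) (ZMod N)) *ᵥ p i = p (s i)) :
    ¬ LinearIndependent ℂ (fun i => displacement N (p i) *ᵥ ψ) := by
  intro hli
  have hcard : Fintype.card (Fin N) = Module.finrank ℂ (ZMod N → ℂ) := by simp [ZMod.card]
  have : Nonempty (Fin N) := ⟨⟨0, Nat.pos_of_neZero N⟩⟩
  let b := basisOfLinearIndependentOfCardEqFinrank hli hcard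
  apply hU.trace_ne_zero hN
  rw [← Matrix.trace_toLin'_eq]
  refine trace_eq_zero_of_permutes_basis b _ c s hs fun i => ?_
  simp only [b, coe_basisOfLinearIndependentOfCardEqFinrank, Matrix.toLin'_apply,
    mulVec_displacement_mulVec hU hψ, hp]

/-! ### Unions of regular orbits -/

/-- A permutation of order `n` has invariant sets of every size `m * n` inside the set of
points on which its powers act freely, as long as that set is large enough. -/
theorem exists_invariant_finset {X : Type*} [DecidableEq X] (T : Equiv.Perm X) (S : Finset X)
    (hreg : ∀ x ∈ S, ∀ k : ℕ, (T ^ k) x = x → T ^ k = 1) (hST : ∀ x ∈ S, T x ∈ S)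
    (hpos : 0 < orderOf T) (m : ℕ) (hm : m * orderOf T ≤ #S) :
    ∃ P ⊆ S, #P = m * orderOf T ∧ ∀ x ∈ P, T x ∈ P := by
  have hpow : ∀ k : ℕ, ∀ x, ∀ P : Finset X, (∀ x ∈ P, T x ∈ P) → x ∈ P → (T ^ k) x ∈ P := by
    intro k
    induction k with
    | zero => intro x P _ hx; simpa using hx
    | succ k ih =>
      intro x P hP hx
      rw [pow_succ', Equiv.Perm.mul_apply]
      exact hP _ (ih x P hP hx)
  induction m with
  | zero => exact ⟨∅, by simp, by simp, by simp⟩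
  | succ m ih =>
    have hlt : m * orderOf T < #S := by
      rw [add_mul, one_mul] at hm; omega
    obtain ⟨P, hPS, hPc, hPT⟩ := ih hlt.le
    obtain ⟨x, hxS, hxP⟩ := Finset.exists_mem_notMem_of_card_lt_card (hPc ▸ hlt)
    let O : Finset X := (Finset.range (orderOf T)).image fun k => (T ^ k) x
    have hmod : ∀ k : ℕ, (T ^ k) x ∈ O := fun k =>
      Finset.mem_image.mpr ⟨k % orderOf T, Finset.mem_range.mpr (Nat.mod_lt _ hpos),
        by simp only [pow_mod_orderOf]⟩
    have hOc : #O = orderOf T := by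
      rw [Finset.card_image_of_injOn, Finset.card_range]
      -- `T ^ i x = T ^ j x` with `i ≤ j` makes `T ^ i x` a fixed point of `T ^ (j - i)`.
      have aux : ∀ i j : ℕ, i ≤ j → j < orderOf T → (T ^ i) x = (T ^ j) x → i = j := by
        intro i j hij hj h
        obtain ⟨d, rfl⟩ := Nat.exists_eq_add_of_le hij
        rw [pow_add, Equiv.Perm.mul_apply, EmbeddingLike.apply_eq_iff_eq] at h
        have hd := Nat.eq_zero_of_dvd_of_lt (orderOf_dvd_of_pow_eq_one (hreg x hxS d h.symm))
          (by omega)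
        omega
      intro i hi j hj h
      simp only [Finset.coe_range, Set.mem_Iio] at hi hj
      rcases le_total i j with hij | hij
      · exact aux i j hij hj h
      · exact (aux j i hij hi h.symm).symm
    have hdisj : Disjoint P O := by
      rw [Finset.disjoint_right]
      intro y hy hyP
      obtain ⟨k, hk, rfl⟩ := Finset.mem_image.mp hy
      rw [Finset.mem_range] at hk
      apply hxP
      have := hpow (orderOf T - k) _ P hPT hyP
      rwa [← Equiv.Perm.mul_apply, ← pow_add, Nat.sub_add_cancel hk.le, pow_orderOf_eq_one,
        Equiv.Perm.one_apply] at this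
    refine ⟨P ∪ O, Finset.union_subset hPS ?_, ?_, ?_⟩
    · intro y hy
      obtain ⟨k, _, rfl⟩ := Finset.mem_image.mp hy
      exact hpow k x S hST hxS
    · rw [Finset.card_union_of_disjoint hdisj, hPc, hOc, add_mul, one_mul]
    · intro y hy
      rcases Finset.mem_union.mp hy with hy | hy
      · exact Finset.mem_union_left _ (hPT y hy)
      · obtain ⟨k, _, rfl⟩ := Finset.mem_image.mp hy
        refine Finset.mem_union_right _ ?_
        rw [← Equiv.Perm.mul_apply, ← pow_succ']
        exact hmod _

/-! ### Points on regular orbits -/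

/-- If `A ∈ SL(2, F)` has a nonzero fixed vector then `det (A - 1) = 0`, so `A - 1` is traceless. -/
theorem trace_eq_two_of_mulVec_eq {F : Type*} [Field F] (A : SL(2, F)) {v : Fin 2 → F}
    (hv : v ≠ 0) (h : (A : Matrix (Fin 2) (Fin 2) F) *ᵥ v = v) : A 0 0 + A 1 1 = 2 := by
  have hdet : A 0 0 * A 1 1 - A 0 1 * A 1 0 = 1 := by
    have := A.det_coe
    rwa [Matrix.det_fin_two] at this
  have h0 : ((A : Matrix (Fin 2) (Fin 2) F) - 1).det = 0 :=
    Matrix.exists_mulVec_eq_zero_iff.mp ⟨v, hv, by rw [Matrix.sub_mulVec, h]; simp⟩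
  rw [Matrix.det_fin_two] at h0
  simp only [Matrix.sub_apply, Matrix.one_apply_eq, Matrix.one_apply_ne zero_ne_one,
    Matrix.one_apply_ne one_ne_zero] at h0
  linear_combination hdet - h0

/-- Over a field, the vectors fixed by some nontrivial power of `G` lie on one line. If `A` and `B`
are two such powers, then `A - 1` and `B - 1` are nonzero, traceless and commute, so they are
proportional and have the same kernel. (In characteristic two, traceless matrices include the
scalars, which is why that case is left out.) -/
theorem exists_linear_form_of_pow_fixes {F : Type*} [Field F] (h2 : (2 : F) ≠ 0) (G : SL(2, F)) :
    ∃ a b : F, (a ≠ 0 ∨ b ≠ 0) ∧ ∀ (k : ℕ) (w : Fin 2 → F), a * w 0 + b * w 1 ≠ 0 →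
      ((G ^ k : SL(2, F)) : Matrix (Fin 2) (Fin 2) F) *ᵥ w = w → G ^ k = 1 := by
  by_cases hex : ∃ (k : ℕ) (v : Fin 2 → F), v ≠ 0 ∧
      ((G ^ k : SL(2, F)) : Matrix (Fin 2) (Fin 2) F) *ᵥ v = v ∧ G ^ k ≠ 1
  · obtain ⟨k, v, hv, hkv, hk⟩ := hex
    have htr := trace_eq_two_of_mulVec_eq _ hv hkv
    have main : ∀ (l : ℕ) (w : Fin 2 → F), w ≠ 0 →
        ((G ^ l : SL(2, F)) : Matrix (Fin 2) (Fin 2) F) *ᵥ w = w → G ^ l ≠ 1 →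
        ((G ^ k) 0 0 - 1) * w 0 + (G ^ k) 0 1 * w 1 = 0 ∧
          (G ^ k) 1 0 * w 0 + ((G ^ k) 1 1 - 1) * w 1 = 0 := by
      intro l w hw hlw hl
      have htr' := trace_eq_two_of_mulVec_eq _ hw hlw
      have hcomm : G ^ k * G ^ l = G ^ l * G ^ k := by rw [← pow_add, ← pow_add, add_comm]
      generalize G ^ k = A at htr hcomm ⊢
      generalize G ^ l = B at htr' hcomm hlw hl
      have hc : ∀ i j, A i 0 * B 0 j + A i 1 * B 1 j = B i 0 * A 0 j + B i 1 * A 1 j := by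
        intro i j
        have := congrArg (fun M : SL(2, F) => M i j) hcomm
        simpa [Matrix.SpecialLinearGroup.coe_mul, Matrix.mul_apply, Fin.sum_univ_two] using this
      have hw0 : B 0 0 * w 0 + B 0 1 * w 1 = w 0 := by
        simpa [Matrix.mulVec, dotProduct, Fin.sum_univ_two] using congrFun hlw 0
      have hw1 : B 1 0 * w 0 + B 1 1 * w 1 = w 1 := by
        simpa [Matrix.mulVec, dotProduct, Fin.sum_univ_two] using congrFun hlw 1
      have hyz : A 0 1 * B 1 0 = A 1 0 * B 0 1 := by linear_combination hc 0 0
      have hxy : (A 0 0 - 1) * B 0 1 = A 0 1 * (B 0 0 - 1) := by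
        refine mul_left_cancel₀ h2 ?_
        linear_combination hc 0 1 + B 0 1 * htr - A 0 1 * htr'
      have hzx : A 1 0 * (B 0 0 - 1) = (A 0 0 - 1) * B 1 0 := by
        refine mul_left_cancel₀ h2 ?_
        linear_combination hc 1 0 - B 1 0 * htr + A 1 0 * htr'
      have hB : B 0 0 - 1 ≠ 0 ∨ B 0 1 ≠ 0 ∨ B 1 0 ≠ 0 := by
        by_contra! hB
        obtain ⟨hB0, hB1, hB2⟩ := hB
        apply hl
        ext i j
        fin_cases i <;> fin_cases j
        · simpa using sub_eq_zero.mp hB0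
        · simpa using hB1
        · simpa using hB2
        · have : B 1 1 = 1 := by linear_combination htr' - hB0
          simpa using this
      -- For corresponding entries `s` of `A - 1` and `t` of `B - 1`, proportionality gives
      -- `t • (A - 1) w = s • (B - 1) w = 0`.
      rcases hB with hB | hB | hB
      · constructor <;> refine mul_left_cancel₀ hB ?_
        · linear_combination (A 0 0 - 1) * hw0 - w 1 * hxy
        · linear_combination (A 0 0 - 1) * hw1 + w 0 * hzx
            + (B 0 0 - 1) * w 1 * htr - (A 0 0 - 1) * w 1 * htr'
      · constructor <;> refine mul_left_cancel₀ hB ?_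
        · linear_combination A 0 1 * hw0 + w 0 * hxy
        · linear_combination A 0 1 * hw1 - w 0 * hyz - w 1 * hxy
            + B 0 1 * w 1 * htr - A 0 1 * w 1 * htr'
      · constructor <;> refine mul_left_cancel₀ hB ?_
        · linear_combination A 1 0 * hw0 - w 0 * hzx + w 1 * hyz
        · linear_combination A 1 0 * hw1 + w 1 * hzx
            + B 1 0 * w 1 * htr - A 1 0 * w 1 * htr'
    -- Some row of `G ^ k - 1` is nonzero and serves as the linear form.
    by_cases hrow : (G ^ k) 0 0 - 1 ≠ 0 ∨ (G ^ k) 0 1 ≠ 0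
    · refine ⟨_, _, hrow, fun l w hw hlw => ?_⟩
      by_contra hl
      exact hw (main l w (by rintro rfl; simp at hw) hlw hl).1
    · push Not at hrow
      refine ⟨(G ^ k) 1 0, (G ^ k) 1 1 - 1, ?_, fun l w hw hlw => ?_⟩
      · by_contra! hrow'
        apply hk
        generalize G ^ k = A at hrow hrow'
        ext i j
        fin_cases i <;> fin_cases j
        · simpa using sub_eq_zero.mp hrow.1
        · simpa using hrow.2
        · simpa using hrow'.1
        · simpa using sub_eq_zero.mp hrow'.2
      · by_contra hl
        exact hw (main l w (by rintro rfl; simp at hw) hlw hl).2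
  · push Not at hex
    refine ⟨1, 0, Or.inl one_ne_zero, fun k w hw hk => hex k w ?_ hk⟩
    rintro rfl
    simp at hw

/-- The affine line `a x + b y = 1`. -/
theorem exists_injective_linear_form_ne_zero {F : Type*} [Field F] {a b : F} (h : a ≠ 0 ∨ b ≠ 0) :
    ∃ φ : F → Fin 2 → F, Function.Injective φ ∧ ∀ t, a * φ t 0 + b * φ t 1 ≠ 0 := by
  rcases h with h | h
  · refine ⟨fun t => ![(1 - b * t) / a, t], fun s t hst => by simpa using congrFun hst 1, ?_⟩
    intro t
    have : a * ((1 - b * t) / a) + b * t = 1 := by field_simp; ring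
    simp [this]
  · refine ⟨fun t => ![t, (1 - a * t) / b], fun s t hst => by simpa using congrFun hst 0, ?_⟩
    intro t
    have : a * t + b * ((1 - a * t) / b) = 1 := by field_simp; ring
    simp [this]

theorem exists_injective_regular {u : ℕ} (q : Fin u → ℕ) (hprime : ∀ i, (q i).Prime)
    (hodd : ∀ i, Odd (q i)) (hdistinct : Function.Injective q) {N : ℕ} (hN : N = ∏ i, q i) (G : SL(2, ZMod N)) :
    ∃ φ : ZMod N → Fin 2 → ZMod N, Function.Injective φ ∧ ∀ (t : ZMod N) (k : ℕ),
      ((G ^ k : SL(2, ZMod N)) : Matrix (Fin 2) (Fin 2) (ZMod N)) *ᵥ φ t = φ t → G ^ k = 1 := by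
  subst hN
  have hfact : ∀ i, Fact (q i).Prime := fun i => ⟨hprime i⟩
  have h2 : ∀ i, (2 : ZMod (q i)) ≠ 0 := fun i h => by
    have hd := (ZMod.natCast_eq_zero_iff 2 (q i)).mp (by exact_mod_cast h)
    have heq := (Nat.prime_dvd_prime_iff_eq (hprime i) Nat.prime_two).mp hd
    exact absurd (hodd i) (by rw [heq]; decide)
  have hcop : Pairwise (Function.onFun Nat.Coprime q) := fun i j hij =>
    (Nat.coprime_primes (hprime i) (hprime j)).mpr (hdistinct.ne hij)
  let e := ZMod.prodEquivPi q hcop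
  let π : ∀ i, ZMod (∏ i, q i) →+* ZMod (q i) := fun i => (Pi.evalRingHom _ i).comp e.toRingHom
  let H : ∀ i, SL(2, ZMod (q i)) := fun i => Matrix.SpecialLinearGroup.map (π i) G
  choose a b hab hreg using fun i => exists_linear_form_of_pow_fixes (h2 i) (H i)
  choose ψ hψ hψ' using fun i => exists_injective_linear_form_ne_zero (hab i)
  refine ⟨fun t j => e.symm fun i => ψ i (e t i) j, ?_, ?_⟩
  · intro s t hst
    apply e.injective
    ext i
    apply hψ i
    ext j
    have := congrArg e (congrFun hst j)
    simp only [RingEquiv.apply_symm_apply] at this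
    exact congrFun this i
  · intro t k hk
    have hHk : ∀ i, H i ^ k = 1 := by
      intro i
      refine hreg i k (ψ i (e t i)) (hψ' i _) ?_
      have hπ : ∀ x, π i (e.symm x) = x i := fun x => by simp [π]
      ext j
      have := congrArg (π i) (congrFun hk j)
      rw [RingHom.map_mulVec] at this
      rw [← map_pow, Matrix.SpecialLinearGroup.map_apply_coe]
      simpa only [Function.comp_def, hπ, RingHom.mapMatrix_apply] using this
    ext r s
    apply e.injective
    ext i
    have := congrArg (fun M : SL(2, ZMod (q i)) => M r s) (hHk i)
    simp only [H, ← map_pow, Matrix.SpecialLinearGroup.map_apply_coe, RingHom.mapMatrix_apply,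
      Matrix.map_apply] at this
    have h1 : π i ((1 : Matrix (Fin 2) (Fin 2) (ZMod (∏ i, q i))) r s)
        = (1 : Matrix (Fin 2) (Fin 2) (ZMod (q i))) r s := by
      rw [Matrix.one_apply, Matrix.one_apply]; split_ifs <;> simp
    exact this.trans h1.symm

/-! ### The permutation action on phase space -/

theorem mulVec_mul_specialLinear {R : Type*} [CommRing R] (G H : SL(2, R)) (p : Fin 2 → R) :
    ((G * H : SL(2, R)) : Matrix (Fin 2) (Fin 2) R) *ᵥ p
      = (G : Matrix (Fin 2) (Fin 2) R) *ᵥ ((H : Matrix (Fin 2) (Fin 2) R) *ᵥ p) := by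
  rw [Matrix.SpecialLinearGroup.coe_mul, Matrix.mulVec_mulVec]

/-- The action of `SL(2, R)` on the points of phase space, as permutations of `R ^ 2`. -/
def pointPerm (R : Type*) [CommRing R] : SL(2, R) →* Equiv.Perm (Fin 2 → R) where
  toFun G :=
    { toFun := fun p => (G : Matrix (Fin 2) (Fin 2) R) *ᵥ p
      invFun := fun p => ((G⁻¹ : SL(2, R)) : Matrix (Fin 2) (Fin 2) R) *ᵥ p
      left_inv := fun p => by
        refine (mulVec_mul_specialLinear G⁻¹ G p).symm.trans ?_
        rw [inv_mul_cancel, Matrix.SpecialLinearGroup.coe_one, Matrix.one_mulVec]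
      right_inv := fun p => by
        refine (mulVec_mul_specialLinear G G⁻¹ p).symm.trans ?_
        rw [mul_inv_cancel, Matrix.SpecialLinearGroup.coe_one, Matrix.one_mulVec] }
  map_one' := by ext1 p; exact Matrix.one_mulVec p
  map_mul' G H := by ext1 p; exact mulVec_mul_specialLinear G H p

theorem pointPerm_apply {R : Type*} [CommRing R] (G : SL(2, R)) (p : Fin 2 → R) :
    pointPerm R G p = (G : Matrix (Fin 2) (Fin 2) R) *ᵥ p := rfl

theorem pointPerm_injective (R : Type*) [CommRing R] : Function.Injective (pointPerm R) := by
  intro G H h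
  apply Subtype.ext
  refine Matrix.ext_of_mulVec_single fun i => ?_
  exact congrArg (fun T : Equiv.Perm (Fin 2 → R) => T (Pi.single i 1)) h

end WeylHeisenberg

open WeylHeisenberg in
theorem theorem6 (u : ℕ) (q : Fin u → ℕ) (hprime : ∀ i, (q i).Prime) (hodd : ∀ i, Odd (q i))
    (hdistinct : Function.Injective q) (N : ℕ) [NeZero N] (hN : N = ∏ i, q i)
    (G : SL(2, ZMod N)) (hG : G ≠ 1) (horder : orderOf G ∣ N) :
    WeylHeisenberg.GeneratesLinearDependencies G := by
  classical
  intro U hU c ψ hψ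
  have hNodd : Odd N := by
    rw [hN]
    exact Finset.prod_induction q Odd (fun _ _ => Odd.mul) odd_one fun i _ => hodd i
  obtain ⟨φ, hφ, hreg⟩ := exists_injective_regular q hprime hodd hdistinct hN G
  let T := pointPerm (ZMod N) G
  have hTo : orderOf T = orderOf G := orderOf_injective _ (pointPerm_injective _) G
  obtain ⟨m, hm⟩ := horder
  -- All points on regular orbits of `⟨G⟩`.
  let S : Finset (Fin 2 → ZMod N) := {x | ∀ k : ℕ, (T ^ k) x = x → T ^ k = 1}
  have hS : N ≤ #S := by
    have h1 : Finset.univ.map ⟨φ, hφ⟩ ⊆ S := by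
      intro x hx
      obtain ⟨t, -, rfl⟩ := Finset.mem_map.mp hx
      refine Finset.mem_filter.mpr ⟨Finset.mem_univ _, fun k hk => ?_⟩
      rw [← map_pow] at hk
      rw [← map_pow, hreg t k hk, map_one]
    simpa [ZMod.card] using Finset.card_le_card h1
  have hST : ∀ x ∈ S, T x ∈ S := by
    intro x hx
    refine Finset.mem_filter.mpr ⟨Finset.mem_univ _, fun k hk => ?_⟩
    refine (Finset.mem_filter.mp hx).2 k (T.injective ?_)
    rwa [← Equiv.Perm.mul_apply, ← pow_succ', pow_succ, Equiv.Perm.mul_apply]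
  obtain ⟨P, hPS, hPc, hPT⟩ := exists_invariant_finset T S
    (fun x hx => (Finset.mem_filter.mp hx).2) hST (orderOf_pos T) m
    (by rw [hTo, mul_comm, ← hm]; exact hS)
  rw [hTo, mul_comm, ← hm] at hPc
  let e : Fin N ≃ P := (P.equivFinOfCardEq hPc).symm
  refine ⟨fun i => e i, Subtype.val_injective.comp e.injective, ?_⟩
  refine not_linearIndependent_of_invariant hNodd hU (c := c) ?_ _
    (fun i => e.symm ⟨T (e i), hPT _ (e i).2⟩) ?_ ?_
  · simpa using hψ.apply_eq_smul
  · intro i hi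
    have hfix : T (e i) = e i := congrArg Subtype.val ((Equiv.symm_apply_eq e).mp hi)
    apply hG
    apply pointPerm_injective
    have := (Finset.mem_filter.mp (hPS (e i).2)).2 1 (by rw [pow_one]; exact hfix)
    rw [map_one]
    rwa [pow_one] at this
  · intro i
    simp [T, pointPerm_apply]
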